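/- Let $d\ge 2$, let $n_1<\cdots<n_d$ be positive integers and let $j\ge 0$ be an integer. Let $S+j=\langle n_1+j,\dots,n_d+j\rangle$ be the subsemigroup (with $0$) of $\mathbb{N}$ generated by $n_1+j,\dots,n_d+j$. A factorization of $s\in S+j$ is a vector $a=(a_1,\dots,a_d)\in\mathbb{N}^d$ with $s=\sum_{i=1}^d a_i(n_i+j)$; put $|a|=\sum_{i=1}^d a_i$. Put $m_i=n_d-n_i$ for $1\le i\le d$ and $g=\gcd(m_1,\dots,m_{d-1})$, let $c$ be the conductor of the numerical semigroup $T=\langle m_1/g,\dots,m_{d-1}/g\rangle$ (the least $c\ge 0$ such that every integer $x\ge c$ lies in $T$), and let $$L=m_1m_2\left(\frac{gc+dm_1}{m_{d-1}}+d\right)-n_d ,$$ so that $L+n_d$ depends only on the differences $n_d-n_i$. Suppose $j>L$. Then: 1. If $a,a'$ are factorizations of an element $s\in S+j$ with $|a|>|a'|$, then $s$ has a factorization $b$ with $|b|=|a|$ and $b_1\ne 0$. 2. $S+j$ is homogeneous, i.e. for each nonzero element $s$ of the Apéry set $\{x\in S+j : x-(n_1+j)\notin S+j\}$ all factorizations $a$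 of $s$ have the same total order $|a|$. 3. For every field $k$, the tangent cone of $S+j$ is Cohen–Macaulay, i.e. the associated graded ring $G(S+j)=\bigoplus_{r\ge 0}\mathfrak m^r/\mathfrak m^{r+1}$ of $R=k[t^{n_1+j},\dots,t^{n_d+j}]\subset k[t]$ with respect to $\mathfrak m=(t^{n_1+j},\dots,t^{n_d+j})$ is a Cohen–Macaulay ring. -/

import Mathlib

open Polynomial

namespace ShiftedSemigroup

/-! Semigroups generated by a finite sequence `n = (n_1, …, n_d)` of natural numbers. The index
`i ∈ {1, …, d}` of the text is the element `i - 1` of `Fin d`. -/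

/-- The additive submonoid `⟨n_1, …, n_d⟩` of `ℕ`. -/
def semigroup {d : ℕ} (n : Fin d → ℕ) : AddSubmonoid ℕ :=
  AddSubmonoid.closure (Set.range n)

/-- The set of factorizations of `s`: all `a ∈ ℕ^d` with `a_1 n_1 + ⋯ + a_d n_d = s`. -/
def factorizations {d : ℕ} (n : Fin d → ℕ) (s : ℕ) : Set (Fin d → ℕ) :=
  {a | ∑ i, a i * n i = s}

/-- The total order `|a| = a_1 + ⋯ + a_d`. -/
def totalOrder {d : ℕ} (a : Fin d → ℕ) : ℕ := ∑ i, a i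

/-- The set of lengths of the factorizations of `s`. -/
def lengths {d : ℕ} (n : Fin d → ℕ) (s : ℕ) : Set ℕ :=
  totalOrder '' factorizations n s

/-- The Apéry set `{x ∈ S | x - s ∉ S}`, the difference being taken in `ℤ`. -/
def aperySet (S : AddSubmonoid ℕ) (s : ℕ) : Set ℕ :=
  {x | x ∈ S ∧ ¬ ∃ y ∈ S, x = y + s}

/-- A set `T` of elements of `⟨n_1, …, n_d⟩` is homogeneous if the set of lengths of every nonzero
element of `T` is a singleton. -/
def IsHomogeneousSet {d : ℕ} (n : Fin d → ℕ) (T : Set ℕ) : Prop :=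
  ∀ s ∈ T, s ≠ 0 → ∃ l, lengths n s = {l}

/-- `⟨n_1, …, n_d⟩` is homogeneous if its Apéry set with respect to `n_1` is homogeneous. -/
def IsHomogeneousSemigroup {d : ℕ} (hd : 2 ≤ d) (n : Fin d → ℕ) : Prop :=
  IsHomogeneousSet n (aperySet (semigroup n) (n ⟨0, by omega⟩))

/-- The shifted sequence `n + j`. -/
def shift {d : ℕ} (n : Fin d → ℕ) (j : ℕ) : Fin d → ℕ := fun i => n i + j

/-! The constant `L`. -/

/-- `m_i = n_d - n_i`. (For an increasing sequence the subtraction does not truncate.) -/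
def diff {d : ℕ} (hd : 2 ≤ d) (n : Fin d → ℕ) (i : Fin d) : ℕ :=
  n ⟨d - 1, by omega⟩ - n i

/-- `g = gcd (m_1, …, m_{d-1})`. (The extra entry `m_d = 0` does not change the gcd.) -/
def diffGcd {d : ℕ} (hd : 2 ≤ d) (n : Fin d → ℕ) : ℕ :=
  Finset.univ.gcd (diff hd n)

/-- `T = ⟨m_1 / g, …, m_{d-1} / g⟩`. (The extra generator `m_d / g = 0` does not change `T`.) -/
def diffSemigroup {d : ℕ} (hd : 2 ≤ d) (n : Fin d → ℕ) : AddSubmonoid ℕ :=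
  semigroup fun i => diff hd n i / diffGcd hd n

/-- The conductor of a numerical semigroup: the least `c` such that all integers `≥ c` belong to
it. -/
noncomputable def conductor (T : AddSubmonoid ℕ) : ℕ :=
  sInf {c | ∀ x, c ≤ x → x ∈ T}

/-- `L = m_1 m_2 ((g c + d m_1) / m_{d-1} + d) - n_d`, a rational number, where `c` is the conductor
of `T`. -/
noncomputable def shiftBound {d : ℕ} (hd : 2 ≤ d) (n : Fin d → ℕ) : ℚ :=
  (diff hd n ⟨0, by omega⟩ : ℚ) * (diff hd n ⟨1, by omega⟩ : ℚ) *
      (((diffGcd hd n : ℚ) * (conductor (diffSemigroup hd n) : ℚ)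
          + (d : ℚ) * (diff hd n ⟨0, by omega⟩ : ℚ)) / (diff hd n ⟨d - 2, by omega⟩ : ℚ) + (d : ℚ))
    - (n ⟨d - 1, by omega⟩ : ℚ)

/-! The tangent cone. -/

/-- The semigroup ring `k[t^{n_1}, …, t^{n_d}] ⊆ k[t]`. -/
noncomputable abbrev semigroupRing (k : Type*) [Field k] {d : ℕ} (n : Fin d → ℕ) :
    Subalgebra k k[X] :=
  Algebra.adjoin k (Set.range fun i => (X : k[X]) ^ n i)

/-- The ideal `(t^{n_1}, …, t^{n_d})` of the semigroup ring. -/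
noncomputable def semigroupIdeal (k : Type*) [Field k] {d : ℕ} (n : Fin d → ℕ) :
    Ideal (semigroupRing k n) :=
  Ideal.span (Set.range fun i =>
    (⟨(X : k[X]) ^ n i, Algebra.subset_adjoin ⟨i, rfl⟩⟩ : semigroupRing k n))

/-- The associated graded ring `gr_I(R) = ⨁ I^r / I^(r+1)`, as the quotient `R[It] / I R[It]` of the
Rees algebra `R[It] = ⨁ I^r t^r`. -/
abbrev AssociatedGradedRing {R : Type*} [CommRing R] (I : Ideal R) : Type _ :=
  reesAlgebra I ⧸ I.map (algebraMap R (reesAlgebra I))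

/-- The coordinate ring `G(S)` of the tangent cone of the semigroup ring of `S = ⟨n_1, …, n_d⟩`. -/
abbrev TangentCone (k : Type*) [Field k] {d : ℕ} (n : Fin d → ℕ) : Type _ :=
  AssociatedGradedRing (semigroupIdeal k n)

/-- A Noetherian local ring is Cohen–Macaulay if its maximal ideal contains a regular sequence
whose length is the Krull dimension, i.e. if its depth equals its dimension. -/
def IsCohenMacaulayLocalRing (A : Type*) [CommRing A] [IsLocalRing A] : Prop :=
  IsNoetherianRing A ∧ ∃ rs : List A, (∀ r ∈ rs, r ∈ IsLocalRing.maximalIdeal A) ∧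
    RingTheory.Sequence.IsRegular A rs ∧ ((rs.length : ℕ∞) : WithBot ℕ∞) = ringKrullDim A

/-- A Noetherian ring is Cohen–Macaulay if all its localizations at primes are. -/
def IsCohenMacaulayRing (R : Type*) [CommRing R] : Prop :=
  IsNoetherianRing R ∧
    ∀ (p : Ideal R) [p.IsPrime], IsCohenMacaulayLocalRing (Localization.AtPrime p)

end ShiftedSemigroup

/-!
Write `N_i = n_i + j`, `m_i = n_d - n_i`. For a vector `a` one has
`∑ a_i N_i + ∑ a_i m_i = |a| N_d`, so factorizations of `s` of a given total order are the ways to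
write one number `M = |a| N_d - s` as a sum of at most `|a|` of the numbers `m_1, …, m_{d-1}`, with
`m_d = 0` as padding.

If `s` also has a shorter factorization, then `M ≥ N_d`. When `a_1 = 0`, at least `M / m_2`
summands are in use. Subtracting `m_1` from `M` as often as possible while staying beyond `g c` leaves
an element of `g T` smaller than `g c + m_1`, so `M` is also a sum of at most
`M / m_1 + (g c + m_1) / m_{d-1}` of the `m_i`, with `m_1` occurring. The bound on `j` makes this less
than `M / m_2` (`exists_factorization_ne_zero`). Homogeneity follows at once
(`isHomogeneousSemigroup_of_exists_ne_zero`).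

For the tangent cone `G`, the `r`-th power of `(t^{N_1}, …, t^{N_d})` consists of the `f` all of whose
exponents have a factorization of total order at least `r` (`mem_semigroupIdeal_pow_iff`). The first
claim then says that the initial form `y` of `t^{N_1}` is regular on `G`, and since it is homogeneous
`G` is torsion-free over `k[y]` (`initialFormEval_mem_nonZeroDivisors`). The initial forms of the
other `t^{N_i}` are nilpotent, because `t^{N_i N_1}` is the `N_i`-th power of `t^{N_1}` and
`N_i > N_1`, so `G` is integral over `k[y]` (`initialFormEval_isIntegral`). A Noetherian ring that is
integral and torsion-free over a principal ideal domain is Cohen–Macaulay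
(`isCohenMacaulayRing_of_isIntegral`): its localizations have dimension zero or one, and in the latter
case a nonzero element of `k[y]` is a parameter.
-/

namespace ShiftedSemigroup

/-! ### Cohen–Macaulay rings from integral extensions of principal ideal domains -/

theorem isCohenMacaulayLocalRing_of_ringKrullDim_le_one {A : Type*} [CommRing A]
    [IsLocalRing A] [IsNoetherianRing A] (hdim : ringKrullDim A ≤ 1)
    (hreg : ringKrullDim A = 1 → ∃ x ∈ IsLocalRing.maximalIdeal A, x ∈ nonZeroDivisors A) :
    IsCohenMacaulayLocalRing A := by
  refine ⟨inferInstance, ?_⟩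
  by_cases h1 : ringKrullDim A = 1
  · obtain ⟨x, hx, hx'⟩ := hreg h1
    refine ⟨[x], by simpa using hx, ⟨?_, ?_⟩, by simp [h1]⟩
    · rw [RingTheory.Sequence.isWeaklyRegular_singleton_iff]
      exact isSMulRegular_iff_right_eq_zero_of_smul.2 fun m hm =>
        (mem_nonZeroDivisors_iff.1 hx').1 m (by simpa using hm)
    · simp only [Ideal.ofList_singleton, smul_eq_mul, Ideal.mul_top]
      intro h
      exact (IsLocalRing.mem_maximalIdeal _).1 hx
        (Ideal.span_singleton_eq_top.1 h.symm)
  · have h0 : ringKrullDim A = 0 := by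
      rw [← IsLocalRing.maximalIdeal_height_eq_ringKrullDim] at hdim h1 ⊢
      norm_cast at hdim h1 ⊢
      exact Order.lt_one_iff.1 (lt_of_le_of_ne hdim h1)
    exact ⟨[], by simp, RingTheory.Sequence.IsRegular.nil _ _, by simp [h0]⟩

/-- A Noetherian ring `B` that is integral and torsion-free over a principal ideal domain `A` is
Cohen–Macaulay. A prime of `B` lying over `0` is minimal by incomparability, so its localization
has dimension zero; any other prime contains the image of a nonzero element of `A`, which is a
regular sequence of length one. -/
theorem isCohenMacaulayRing_of_isIntegral {A B : Type*} [CommRing A] [IsDomain A]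
    [IsPrincipalIdealRing A] [CommRing B] [IsNoetherianRing B] (φ : A →+* B)
    (hint : φ.IsIntegral) (hreg : ∀ f : A, f ≠ 0 → φ f ∈ nonZeroDivisors B) :
    IsCohenMacaulayRing B := by
  algebraize [φ]
  have hmin : ∀ p : Ideal B, p.IsPrime → p.comap φ = ⊥ → p ∈ minimalPrimes B := by
    intro p hp h
    refine ⟨⟨hp, bot_le⟩, fun q ⟨hq, _⟩ hqp => ?_⟩
    by_contra hpq
    obtain ⟨x, hxp, hxq⟩ := Set.not_subset.1 hpq
    have := Ideal.comap_lt_comap_of_integral_mem_sdiff (R := A) hqp ⟨hxp, hxq⟩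
      (Algebra.IsIntegral.isIntegral x)
    rw [show p.comap (algebraMap A B) = ⊥ from h] at this
    exact not_lt_bot this
  have hdim : Ring.KrullDimLE 1 B := by
    refine Ring.KrullDimLE.mk₁ fun p hp => ?_
    by_cases h : p.comap φ = ⊥
    · exact .inl (hmin p hp h)
    · right
      have : (p.comap (algebraMap A B)).IsMaximal :=
        Ideal.IsPrime.isMaximal_of_ne_bot inferInstance h
      exact Ideal.isMaximal_of_isIntegral_of_isMaximal_comap p this
  refine ⟨inferInstance, fun p hp => ?_⟩
  have hnoeth : IsNoetherianRing (Localization.AtPrime p) :=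
    IsLocalization.isNoetherianRing p.primeCompl _ inferInstance
  have hht : ringKrullDim (Localization.AtPrime p) = p.height :=
    IsLocalization.AtPrime.ringKrullDim_eq_height p _
  refine isCohenMacaulayLocalRing_of_ringKrullDim_le_one ?_ fun h1 => ?_
  · rw [hht]
    refine Ideal.height_le_ringKrullDim_of_isPrime.trans ?_
    exact_mod_cast Ring.krullDimLE_iff.1 hdim
  · have hne : p.comap φ ≠ ⊥ := by
      intro h
      have h0 : p.height = 0 := Ideal.height_eq_zero_iff.2 (hmin p hp h)
      rw [hht, h0] at h1
      simp at h1
    obtain ⟨f, hf, hf0⟩ := Submodule.exists_mem_ne_zero_of_ne_bot hne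
    refine ⟨algebraMap B _ (φ f), ?_, ?_⟩
    · exact (IsLocalization.AtPrime.to_map_mem_maximal_iff _ p _).2 hf
    · exact IsLocalization.map_nonZeroDivisors_le p.primeCompl _ ⟨_, hreg f hf0, rfl⟩

/-! ### The associated graded ring over a polynomial ring in one initial form -/

section AssociatedGraded

variable {k R : Type*} [Field k] [CommRing R] [Algebra k R] (I : Ideal R)

/-- The degree `i` part of the extension of `I` to the Rees algebra is `I^(i+1)`, so that
`I^i / I^(i+1)` is the degree `i` part of `AssociatedGradedRing I`. -/
theorem mem_map_algebraMap_reesAlgebra_iff (f : reesAlgebra I) :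
    f ∈ I.map (algebraMap R (reesAlgebra I)) ↔ ∀ i, (f : R[X]).coeff i ∈ I ^ (i + 1) := by
  constructor
  · intro hf
    induction hf using Submodule.span_induction with
    | mem f hf =>
      obtain ⟨a, ha, rfl⟩ := hf
      intro i
      rw [Subalgebra.coe_algebraMap, Polynomial.algebraMap_apply,
        Algebra.algebraMap_self_apply, coeff_C]
      split_ifs with h
      · simpa [h] using ha
      · exact zero_mem _
    | zero => intro i; simp
    | add f g _ _ hf hg => intro i; simpa using add_mem (hf i) (hg i)
    | smul a f _ hf =>
      intro i
      rw [smul_eq_mul, Subalgebra.coe_mul, coeff_mul]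
      refine Ideal.sum_mem _ fun p hp => ?_
      rw [← Finset.HasAntidiagonal.mem_antidiagonal.1 hp, add_assoc, pow_add]
      exact Ideal.mul_mem_mul (a.2 _) (hf _)
  · intro hf
    have key : ∀ i, ∀ a ∈ I ^ (i + 1), ∃ h : monomial i a ∈ reesAlgebra I,
        (⟨monomial i a, h⟩ : reesAlgebra I) ∈ I.map (algebraMap R (reesAlgebra I)) := by
      intro i a ha
      rw [pow_succ'] at ha
      refine Submodule.smul_induction_on ha ?_ ?_
      · intro a ha b hb
        have hb' : monomial i b ∈ reesAlgebra I := reesAlgebra.monomial_mem.2 hb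
        have h := Ideal.mul_mem_right (⟨monomial i b, hb'⟩ : reesAlgebra I) _
          (Ideal.mem_map_of_mem (algebraMap R (reesAlgebra I)) ha)
        have he : algebraMap R (reesAlgebra I) a * ⟨monomial i b, hb'⟩ =
            ⟨monomial i (a • b), reesAlgebra.monomial_mem.2 (Ideal.mul_mem_left _ a hb)⟩ := by
          ext1
          simp [C_mul_monomial]
        exact ⟨_, he ▸ h⟩
      · rintro a b ⟨ha, ha'⟩ ⟨hb, hb'⟩
        have h := add_mem ha' hb'
        have he : (⟨monomial i a, ha⟩ + ⟨monomial i b, hb⟩ : reesAlgebra I) =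
            ⟨monomial i (a + b), by rw [map_add]; exact add_mem ha hb⟩ := by
          ext1
          simp
        exact ⟨_, he ▸ h⟩
    have : f = ∑ i ∈ (f : R[X]).support,
        (⟨monomial i ((f : R[X]).coeff i), reesAlgebra.monomial_mem.2 (f.2 i)⟩ :
          reesAlgebra I) := by
      ext1
      rw [AddSubmonoidClass.coe_finsetSum]
      exact (f : R[X]).as_sum_support
    rw [this]
    exact Ideal.sum_mem _ fun i _ => (key i _ (hf i)).2

variable {I} {G : Type*} [CommRing G] (π : reesAlgebra I →+* G)

/-- The element `x t` of the Rees algebra `R[It]`, for `x ∈ I`. -/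
noncomputable def degreeOne {x : R} (hx : x ∈ I) : reesAlgebra I :=
  ⟨monomial 1 x, reesAlgebra.monomial_mem.2 (by simpa using hx)⟩

variable (k) in
/-- For `x ∈ I`, the `k`-algebra homomorphism `k[X] → G` sending `X` to the initial form of `x`, the
image of `x t`. The ring `G` receives a map `π` from the Rees algebra; it stands for the associated
graded ring, where `π` is surjective with kernel generated by `I`. -/
noncomputable def initialFormEval {x : R} (hx : x ∈ I) : k[X] →+* G :=
  π.comp
    (eval₂RingHom ((algebraMap R (reesAlgebra I)).comp (algebraMap k R)) (degreeOne hx))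

theorem coeff_eval₂_degreeOne {x : R} (hx : x ∈ I) (p : k[X]) (i : ℕ) :
    (eval₂RingHom ((algebraMap R (reesAlgebra I)).comp (algebraMap k R)) (degreeOne hx) p :
      R[X]).coeff i = algebraMap k R (p.coeff i) * x ^ i := by
  have : (eval₂RingHom ((algebraMap R (reesAlgebra I)).comp (algebraMap k R)) (degreeOne hx) p :
      R[X]) = (p.map (algebraMap k R)).comp (C x * X) := by
    rw [coe_eval₂RingHom, comp, eval₂_map]
    change (reesAlgebra I).val.toRingHom _ = _
    rw [hom_eval₂]
    congr 1
    change monomial 1 x = _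
    rw [C_mul_X_eq_monomial]
  rw [this, comp_C_mul_X_coeff, coeff_map]

/-- If multiplication by `x` raises the `I`-adic order by exactly one, then `G` is torsion-free over
`k[X]`: the trailing term of `p` times the lowest component of a nonzero element of `G` cannot
vanish. -/
theorem initialFormEval_mem_nonZeroDivisors (hπ : Function.Surjective π)
    (hker : RingHom.ker π = I.map (algebraMap R (reesAlgebra I))) {x : R} (hx : x ∈ I)
    (hreg : ∀ r, ∀ f : R, x * f ∈ I ^ (r + 1) → f ∈ I ^ r) (p : k[X]) (hp : p ≠ 0) :
    initialFormEval k π hx p ∈ nonZeroDivisors G := by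
  have hreg' : ∀ m r, ∀ f : R, x ^ m * f ∈ I ^ (r + m) → f ∈ I ^ r := by
    intro m
    induction m with
    | zero => intro r f hf; simpa using hf
    | succ m ih =>
      intro r f hf
      refine ih r f (hreg _ _ ?_)
      rwa [← mul_assoc, ← pow_succ', add_assoc]
  refine mem_nonZeroDivisors_iff_right.2 fun f hf => ?_
  obtain ⟨f, rfl⟩ := hπ f
  rw [initialFormEval, RingHom.comp_apply, ← map_mul, ← RingHom.mem_ker, hker,
    mem_map_algebraMap_reesAlgebra_iff] at hf
  rw [← RingHom.mem_ker, hker, mem_map_algebraMap_reesAlgebra_iff]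
  intro r
  induction r using Nat.strong_induction_on with
  | _ r ih =>
    -- In degree `r + m` the only term of the product not already known to vanish in `G` is the
    -- trailing term of `p` times the degree `r` component of `f`.
    set m := p.natTrailingDegree
    have hc : p.coeff m ≠ 0 := trailingCoeff_nonzero_iff_nonzero.2 hp
    have h := hf (r + m)
    rw [Subalgebra.coe_mul, coeff_mul, ← Finset.add_sum_erase _ _
      (a := (r, m)) (by simp)] at h
    have hrest : ∑ q ∈ (Finset.HasAntidiagonal.antidiagonal (r + m)).erase (r, m),
        (f : R[X]).coeff q.1 * (eval₂RingHom ((algebraMap R (reesAlgebra I)).comp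
          (algebraMap k R)) (degreeOne hx) p : R[X]).coeff q.2 ∈ I ^ (r + m + 1) := by
      refine Ideal.sum_mem _ fun q hq => ?_
      obtain ⟨hne, hq⟩ := Finset.mem_erase.1 hq
      rw [Finset.HasAntidiagonal.mem_antidiagonal] at hq
      rw [coeff_eval₂_degreeOne]
      rcases lt_trichotomy q.2 m with hlt | heq | hgt
      · rw [coeff_eq_zero_of_lt_natTrailingDegree hlt]
        simp
      · exact absurd (Prod.ext (by omega) heq) hne
      · have := Ideal.mul_mem_mul (ih q.1 (by omega))
          (Ideal.mul_mem_left _ (algebraMap k R (p.coeff q.2)) (Ideal.pow_mem_pow hx q.2))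
        rwa [← pow_add, show q.1 + 1 + q.2 = r + m + 1 by omega] at this
    have hlead := (Ideal.add_mem_iff_left _ hrest).1 h
    rw [coeff_eval₂_degreeOne] at hlead
    have := Ideal.mul_mem_left _ (algebraMap k R (p.coeff m)⁻¹) hlead
    refine hreg' m _ _ ?_
    have he : x ^ m * (f : R[X]).coeff r = algebraMap k R (p.coeff m)⁻¹ *
        ((f : R[X]).coeff r * (algebraMap k R (p.coeff m) * x ^ m)) := by
      have h1 : algebraMap k R (p.coeff m)⁻¹ * algebraMap k R (p.coeff m) = 1 := by
        rw [← map_mul, inv_mul_cancel₀ hc, map_one]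
      linear_combination (-(x ^ m * (f : R[X]).coeff r)) * h1
    rw [he, show r + 1 + m = r + m + 1 by omega]
    exact this

/-- If every generator of `I` other than `x` has nilpotent initial form, and every element
of `R` is congruent to a constant modulo `I`, then `G` is integral over `k[X]`. -/
theorem initialFormEval_isIntegral (hπ : Function.Surjective π)
    (hker : RingHom.ker π = I.map (algebraMap R (reesAlgebra I))) {ι : Type*} {g : ι → R}
    (hI : I = Ideal.span (Set.range g))
    (hres : ∀ r : R, ∃ c : k, r - algebraMap k R c ∈ I) {x : R} (hx : x ∈ I)
    (hg : ∀ i, g i = x ∨ ∃ e, g i ^ e ∈ I ^ (e + 1)) :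
    (initialFormEval k π hx).IsIntegral := by
  set φ := initialFormEval k π hx
  have hbase : ∀ r : R, φ.IsIntegralElem (π (algebraMap R _ r)) := by
    intro r
    obtain ⟨c, hc⟩ := hres r
    have : π (algebraMap R _ r) = φ (C c) := by
      rw [← sub_eq_zero]
      simp only [φ, initialFormEval, RingHom.comp_apply, coe_eval₂RingHom, eval₂_C]
      rw [← map_sub, ← map_sub, ← RingHom.mem_ker, hker]
      exact Ideal.mem_map_of_mem _ hc
    rw [this]
    exact φ.isIntegralElem_map
  have hone : ∀ a, ∀ ha : a ∈ I, φ.IsIntegralElem (π (degreeOne ha)) := by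
    intro a ha
    have ha' := ha
    rw [hI] at ha'
    induction ha' using Submodule.span_induction with
    | mem a hag =>
      obtain ⟨i, rfl⟩ := hag
      rcases hg i with rfl | ⟨e, he⟩
      · have : π (degreeOne ha) = φ X := by simp [φ, initialFormEval]
        rw [this]
        exact φ.isIntegralElem_map
      · have h0 : π (degreeOne ha) ^ e = 0 := by
          rw [← map_pow, ← RingHom.mem_ker, hker, mem_map_algebraMap_reesAlgebra_iff]
          intro n
          rw [Subalgebra.coe_pow, degreeOne, monomial_pow, one_mul, coeff_monomial]
          split_ifs with h
          · exact h ▸ he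
          · exact zero_mem _
        refine ⟨X ^ e, monic_X_pow e, ?_⟩
        simp [h0]
    | zero =>
      have : degreeOne ha = 0 := by ext1; simp [degreeOne]
      rw [this, map_zero]
      exact φ.isIntegralElem_zero
    | add a b h1 h2 iha ihb =>
      change a ∈ Ideal.span _ at h1
      change b ∈ Ideal.span _ at h2
      rw [← hI] at h1 h2
      have : degreeOne ha = degreeOne h1 + degreeOne h2 := by ext1; simp [degreeOne]
      rw [this, map_add]
      exact (iha h1).add φ (ihb h2)
    | smul r a h1 iha =>
      change a ∈ Ideal.span _ at h1
      rw [← hI] at h1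
      have : degreeOne ha = algebraMap R _ r * degreeOne h1 := by
        ext1; simp [degreeOne, C_mul_monomial]
      rw [this, map_mul]
      exact (hbase r).mul φ (iha h1)
  let S : Subalgebra R (reesAlgebra I) :=
    { carrier := {f | φ.IsIntegralElem (π f)}
      mul_mem' := fun {a b} ha hb => by
        change φ.IsIntegralElem _; rw [map_mul]; exact RingHom.IsIntegralElem.mul φ ha hb
      add_mem' := fun {a b} ha hb => by
        change φ.IsIntegralElem _; rw [map_add]; exact RingHom.IsIntegralElem.add φ ha hb
      algebraMap_mem' := hbase }
  have hS : reesAlgebra I ≤ S.map (reesAlgebra I).val := by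
    refine (adjoin_monomial_eq_reesAlgebra I).ge.trans (Algebra.adjoin_le ?_)
    rintro _ ⟨a, ha, rfl⟩
    exact ⟨degreeOne ha, hone a ha, rfl⟩
  intro z
  obtain ⟨f, rfl⟩ := hπ z
  obtain ⟨f', hf', he⟩ := hS f.2
  rw [← show f' = f from Subtype.ext he]
  exact hf'

theorem isCohenMacaulayRing_of_ker_eq (hπ : Function.Surjective π)
    (hker : RingHom.ker π = I.map (algebraMap R (reesAlgebra I))) [IsNoetherianRing R]
    {ι : Type*} {g : ι → R} (hI : I = Ideal.span (Set.range g))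
    (hres : ∀ r : R, ∃ c : k, r - algebraMap k R c ∈ I) {x : R} (hx : x ∈ I)
    (hg : ∀ i, g i = x ∨ ∃ e, g i ^ e ∈ I ^ (e + 1))
    (hreg : ∀ r, ∀ f : R, x * f ∈ I ^ (r + 1) → f ∈ I ^ r) :
    IsCohenMacaulayRing G := by
  have : IsNoetherianRing G := isNoetherianRing_of_surjective _ _ π hπ
  exact isCohenMacaulayRing_of_isIntegral (initialFormEval k π hx)
    (initialFormEval_isIntegral π hπ hker hI hres hx hg)
    (initialFormEval_mem_nonZeroDivisors π hπ hker hx hreg)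

/-- A criterion for the associated graded ring to be Cohen–Macaulay of dimension at most one: `x` has
a regular initial form, and the initial forms of the other generators of `I` are nilpotent. -/
theorem isCohenMacaulayRing_associatedGradedRing [IsNoetherianRing R] {ι : Type*} {g : ι → R}
    (hI : I = Ideal.span (Set.range g)) (hres : ∀ r : R, ∃ c : k, r - algebraMap k R c ∈ I)
    {x : R} (hx : x ∈ I) (hg : ∀ i, g i = x ∨ ∃ e, g i ^ e ∈ I ^ (e + 1))
    (hreg : ∀ r, ∀ f : R, x * f ∈ I ^ (r + 1) → f ∈ I ^ r) :
    IsCohenMacaulayRing (AssociatedGradedRing I) :=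
  isCohenMacaulayRing_of_ker_eq (Ideal.Quotient.mk (I.map (algebraMap R (reesAlgebra I))))
    Ideal.Quotient.mk_surjective Ideal.mk_ker hI hres hx hg hreg

end AssociatedGraded

/-! ### Factorizations and total orders -/

section Factorizations
variable {d : ℕ} {n : Fin d → ℕ}

theorem mem_semigroup_iff {s : ℕ} : s ∈ semigroup n ↔ (factorizations n s).Nonempty := by
  rw [semigroup, ← Submodule.span_nat_eq_addSubmonoidClosure, Submodule.mem_toAddSubmonoid,
    Submodule.mem_span_range_iff_exists_fun]
  rfl

theorem zero_mem_factorizations : (0 : Fin d → ℕ) ∈ factorizations n 0 := by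
  simp [factorizations]

theorem add_mem_factorizations {s t : ℕ} {a b : Fin d → ℕ} (ha : a ∈ factorizations n s)
    (hb : b ∈ factorizations n t) : a + b ∈ factorizations n (s + t) := by
  rw [← show _ = s from ha, ← show _ = t from hb]
  simp [factorizations, add_mul, Finset.sum_add_distrib]

theorem single_mem_factorizations (i : Fin d) (e : ℕ) :
    Pi.single i e ∈ factorizations n (e * n i) := by
  change ∑ l, _ = _
  rw [Finset.sum_eq_single i (fun l _ h => by simp [h]) (by simp), Pi.single_eq_same]

theorem totalOrder_add (a b : Fin d → ℕ) : totalOrder (a + b) = totalOrder a + totalOrder b := by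
  simp [totalOrder, Finset.sum_add_distrib]

theorem totalOrder_single (i : Fin d) (e : ℕ) : totalOrder (Pi.single i e) = e := by
  simp [totalOrder]

theorem sub_single_mem_factorizations {s : ℕ} {i : Fin d} {b : Fin d → ℕ}
    (hb : b ∈ factorizations n (s + n i)) (hi : b i ≠ 0) :
    ∃ a ∈ factorizations n s, totalOrder b = totalOrder a + 1 := by
  have h : b = b - (Pi.single i 1 : Fin d → ℕ) + Pi.single i 1 := by
    funext l
    by_cases hl : l = i
    · subst hl
      simp only [Pi.add_apply, Pi.sub_apply, Pi.single_eq_same]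
      omega
    · simp [hl]
  refine ⟨b - (Pi.single i 1 : Fin d → ℕ), ?_, ?_⟩
  · have h1 := single_mem_factorizations (n := n) i 1
    rw [h] at hb
    have h2 : ∑ l, (b - Pi.single i 1 + Pi.single i 1 : Fin d → ℕ) l * n l = s + n i := hb
    have h3 : ∑ l, (Pi.single i 1 : Fin d → ℕ) l * n l = 1 * n i := h1
    simp only [Pi.add_apply, add_mul, Finset.sum_add_distrib] at h2
    change ∑ l, _ = s
    omega
  · conv_lhs => rw [h]
    rw [totalOrder_add, totalOrder_single]

end Factorizations

/-! ### The powers of the ideal `(t^{n_1}, …, t^{n_d})` -/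

section SemigroupRing
variable {k : Type*} [Field k] {d : ℕ} {n : Fin d → ℕ}

/-- The elements that have a factorization of total order at least `r`, i.e. the exponents `s` with
`t^s ∈ (t^{n_1}, …, t^{n_d})^r`. -/
def longElements (n : Fin d → ℕ) (r : ℕ) : Set ℕ :=
  {s | ∃ a ∈ factorizations n s, r ≤ totalOrder a}

theorem longElements_anti {r t : ℕ} (h : r ≤ t) : longElements n t ⊆ longElements n r :=
  fun _ ⟨a, ha, hl⟩ => ⟨a, ha, h.trans hl⟩

theorem add_mem_longElements {r t s u : ℕ} (hs : s ∈ longElements n r)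
    (hu : u ∈ longElements n t) : s + u ∈ longElements n (r + t) := by
  obtain ⟨a, ha, hl⟩ := hs
  obtain ⟨b, hb, hl'⟩ := hu
  exact ⟨a + b, add_mem_factorizations ha hb, by rw [totalOrder_add]; omega⟩

theorem support_mul_subset_longElements {r t : ℕ} {f g : k[X]}
    (hf : ↑f.support ⊆ longElements n r) (hg : ↑g.support ⊆ longElements n t) :
    ↑(f * g).support ⊆ longElements n (r + t) := by
  intro s hs
  rw [Finset.mem_coe, mem_support_iff, coeff_mul] at hs
  obtain ⟨p, hp, hne⟩ := Finset.exists_ne_zero_of_sum_ne_zero hs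
  rw [← Finset.HasAntidiagonal.mem_antidiagonal.1 hp]
  exact add_mem_longElements (hf (by simpa using left_ne_zero_of_mul hne))
    (hg (by simpa using right_ne_zero_of_mul hne))

theorem support_add_subset_of_subset {T : Set ℕ} {f g : k[X]} (hf : ↑f.support ⊆ T)
    (hg : ↑g.support ⊆ T) : ↑(f + g).support ⊆ T := fun _ hs =>
  (Finset.mem_union.1 (support_add hs)).elim (fun h => hf h) fun h => hg h

theorem support_X_pow_subset_longElements (i : Fin d) :
    ↑((X : k[X]) ^ n i).support ⊆ longElements n 1 := by
  intro s hs
  have : s = 1 * n i := by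
    rw [support_X_pow] at hs
    simpa using hs
  exact this ▸ ⟨_, single_mem_factorizations i 1, (totalOrder_single i 1).ge⟩

theorem support_subset_longElements_zero (f : semigroupRing k n) :
    ↑(f : k[X]).support ⊆ longElements n 0 := by
  obtain ⟨f, hf⟩ := f
  induction hf using Algebra.adjoin_induction with
  | mem f hf =>
    obtain ⟨i, rfl⟩ := hf
    exact (support_X_pow_subset_longElements i).trans (longElements_anti zero_le_one)
  | algebraMap c =>
    intro s hs
    have : s = 0 := by simpa using support_C_subset c hs
    subst this
    exact ⟨0, zero_mem_factorizations, Nat.zero_le _⟩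
  | add f g _ _ hf hg => exact support_add_subset_of_subset hf hg
  | mul f g _ _ hf hg => exact support_mul_subset_longElements hf hg

theorem support_subset_longElements_of_mem_pow {f : semigroupRing k n} {r : ℕ}
    (hf : f ∈ semigroupIdeal k n ^ r) : ↑(f : k[X]).support ⊆ longElements n r := by
  have hone : ∀ f ∈ semigroupIdeal k n, ↑(f : k[X]).support ⊆ longElements n 1 := by
    intro f hf
    induction hf using Submodule.span_induction with
    | mem f hf => obtain ⟨i, rfl⟩ := hf; exact support_X_pow_subset_longElements i
    | zero => simp
    | add f g _ _ hf hg => exact support_add_subset_of_subset hf hg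
    | smul a f _ hf =>
      exact zero_add 1 ▸ support_mul_subset_longElements (support_subset_longElements_zero a) hf
  induction r generalizing f with
  | zero => exact support_subset_longElements_zero f
  | succ r ih =>
    rw [pow_succ] at hf
    refine Submodule.smul_induction_on hf (fun f hf g hg => ?_) fun f g hf hg => ?_
    · exact support_mul_subset_longElements (ih hf) (hone g hg)
    · exact support_add_subset_of_subset hf hg

theorem exists_X_pow_mem_pow {s r : ℕ} (hs : s ∈ longElements n r) :
    ∃ f ∈ semigroupIdeal k n ^ r, (f : k[X]) = X ^ s := by
  obtain ⟨a, ha, hl⟩ := hs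
  refine ⟨∏ i, (⟨X ^ n i, Algebra.subset_adjoin ⟨i, rfl⟩⟩ : semigroupRing k n) ^ a i,
    Ideal.pow_le_pow_right hl ?_, ?_⟩
  · rw [totalOrder, ← Finset.prod_pow_eq_pow_sum]
    exact Ideal.prod_mem_prod fun i _ =>
      Ideal.pow_mem_pow (Ideal.subset_span (Set.mem_range_self i)) _
  · rw [← show _ = s from ha]
    simp [← pow_mul, Finset.prod_pow_eq_pow_sum, mul_comm]

/-- The powers of the ideal `(t^{n_1}, …, t^{n_d})` are monomial: membership of `f` in the `r`-th
power is a condition on each exponent of `f` separately. -/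
theorem mem_semigroupIdeal_pow_iff {f : semigroupRing k n} {r : ℕ} :
    f ∈ semigroupIdeal k n ^ r ↔ ↑(f : k[X]).support ⊆ longElements n r := by
  refine ⟨support_subset_longElements_of_mem_pow, fun h => ?_⟩
  choose! m hm hm' using fun s (hs : s ∈ longElements n r) => exists_X_pow_mem_pow (k := k) hs
  have : f = ∑ s ∈ (f : k[X]).support, algebraMap k _ ((f : k[X]).coeff s) * m s := by
    ext1
    rw [AddSubmonoidClass.coe_finsetSum]
    conv_lhs => rw [(f : k[X]).as_sum_support_C_mul_X_pow]
    refine Finset.sum_congr rfl fun s hs => ?_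
    rw [← hm' s (h hs)]
    rfl
  rw [this]
  exact Ideal.sum_mem _ fun s hs => Ideal.mul_mem_left _ _ (hm s (h hs))

instance isNoetherianRing_semigroupRing : IsNoetherianRing (semigroupRing k n) :=
  haveI : Algebra.FiniteType k (semigroupRing k n) :=
    (Subalgebra.fg_iff_finiteType _).1 (Subalgebra.fg_def.2 ⟨_, Set.finite_range _, rfl⟩)
  Algebra.FiniteType.isNoetherianRing k _

theorem exists_sub_algebraMap_mem_semigroupIdeal (f : semigroupRing k n) :
    ∃ c : k, f - algebraMap k _ c ∈ semigroupIdeal k n := by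
  refine ⟨(f : k[X]).coeff 0, ?_⟩
  rw [← pow_one (semigroupIdeal k n), mem_semigroupIdeal_pow_iff]
  intro s hs
  obtain ⟨a, ha, -⟩ := support_subset_longElements_zero _ hs
  refine ⟨a, ha, Nat.one_le_iff_ne_zero.2 fun h0 => ?_⟩
  have ha0 : ∀ i, a i = 0 := by simpa [totalOrder, Finset.sum_eq_zero_iff] using h0
  have : s = 0 := by rw [← show _ = s from ha]; simp [ha0]
  subst this
  rw [Finset.mem_coe, mem_support_iff] at hs
  refine hs ?_
  change ((f : k[X]) - C _).coeff 0 = 0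
  simp

/-- If `n i₀` is the least generator and adding it to an element of the semigroup raises the maximal
total order by at most one, then the tangent cone is Cohen–Macaulay, because the initial form of
`t^{n i₀}` is regular. -/
theorem isCohenMacaulayRing_tangentCone (i₀ : Fin d) (hlt : ∀ i, i ≠ i₀ → n i₀ < n i)
    (h : ∀ s ∈ semigroup n, ∀ a ∈ factorizations n (s + n i₀),
      ∃ b ∈ factorizations n s, totalOrder a ≤ totalOrder b + 1) :
    IsCohenMacaulayRing (TangentCone k n) := by
  refine isCohenMacaulayRing_associatedGradedRing (k := k) rfl
    exists_sub_algebraMap_mem_semigroupIdeal (Ideal.subset_span (Set.mem_range_self i₀))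
    (fun i => ?_) fun r f hf => ?_
  · rcases eq_or_ne i i₀ with rfl | hi
    · exact .inl rfl
    · refine .inr ⟨n i₀, mem_semigroupIdeal_pow_iff.2 fun s hs => ?_⟩
      -- The exponent `n i * n i₀` is also `n i` copies of the smaller generator `n i₀`, a
      -- factorization of total order `n i > n i₀`.
      refine ⟨Pi.single i₀ (n i), ?_, by rw [totalOrder_single]; exact hlt i hi⟩
      have : s = n i * n i₀ := by
        rw [SubmonoidClass.coe_pow, ← pow_mul, support_X_pow] at hs
        simpa using hs
      exact this ▸ single_mem_factorizations i₀ (n i)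
  · rw [mem_semigroupIdeal_pow_iff] at hf ⊢
    intro s hs
    obtain ⟨c, hc, -⟩ := support_subset_longElements_zero f hs
    obtain ⟨a, ha, hl⟩ := @hf (s + n i₀) (by
      rw [Finset.mem_coe, mem_support_iff] at hs ⊢
      change (X ^ n i₀ * (f : k[X])).coeff (s + n i₀) ≠ 0
      rwa [mul_comm, coeff_mul_X_pow])
    obtain ⟨b, hb, hl'⟩ := h s (mem_semigroup_iff.2 ⟨c, hc⟩) a ha
    exact ⟨b, hb, by omega⟩

end SemigroupRing

/-! ### The shifted family -/

section Shift
variable {d : ℕ} {hd : 2 ≤ d} {n : Fin d → ℕ}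

theorem diff_add_shift (hn : StrictMono n) (j : ℕ) (i : Fin d) :
    diff hd n i + shift n j i = n ⟨d - 1, by omega⟩ + j := by
  have : n i ≤ n ⟨d - 1, by omega⟩ := hn.monotone (Fin.le_def.2 (by simp; omega))
  simp only [diff, shift]
  omega

theorem diff_lt_diff (hn : StrictMono n) {i l : Fin d} (h : i < l) :
    diff hd n l < diff hd n i := by
  have h1 := hn h
  have h2 : n l ≤ n ⟨d - 1, by omega⟩ := hn.monotone (Fin.le_def.2 (by simp; omega))
  simp only [diff]
  omega

theorem diff_le_diff (hn : StrictMono n) {i l : Fin d} (h : i ≤ l) :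
    diff hd n l ≤ diff hd n i :=
  h.eq_or_lt.elim (fun h => h ▸ le_rfl) fun h => (diff_lt_diff hn h).le

theorem diff_last : diff hd n ⟨d - 1, by omega⟩ = 0 := by
  simp [diff]

/-- For fixed total order, being a factorization of `s` in the shifted generators is a condition on
`∑ a_i m_i` alone. -/
theorem sum_mul_shift_add_sum_mul_diff (hn : StrictMono n) (j : ℕ) (a : Fin d → ℕ) :
    ∑ i, a i * shift n j i + ∑ i, a i * diff hd n i =
      totalOrder a * (n ⟨d - 1, by omega⟩ + j) := by
  rw [← Finset.sum_add_distrib, totalOrder, Finset.sum_mul]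
  refine Finset.sum_congr rfl fun i _ => ?_
  rw [← diff_add_shift (hd := hd) hn j i]
  ring

theorem diffGcd_dvd (i : Fin d) : diffGcd hd n ∣ diff hd n i :=
  Finset.gcd_dvd (Finset.mem_univ i)

theorem diffGcd_pos (hn : StrictMono n) : 0 < diffGcd hd n := by
  have h : 0 < diff hd n ⟨0, by omega⟩ :=
    (Nat.zero_le _).trans_lt (diff_lt_diff (l := ⟨1, by omega⟩) hn (by simp [Fin.lt_def]))
  exact Nat.pos_of_dvd_of_pos (diffGcd_dvd _) h

/-- The generators `m_i / g` have greatest common divisor one, so that the infimum defining the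
conductor is attained. -/
theorem mem_diffSemigroup_of_conductor_le (hn : StrictMono n) {x : ℕ}
    (hx : conductor (diffSemigroup hd n) ≤ x) : x ∈ diffSemigroup hd n := by
  have hg : Nat.setGcd (Set.range fun i => diff hd n i / diffGcd hd n) = 1 := by
    have h : diffGcd hd n * Nat.setGcd (Set.range fun i => diff hd n i / diffGcd hd n) ∣
        diffGcd hd n * 1 := by
      rw [mul_one]
      conv_rhs => rw [diffGcd]
      refine Finset.dvd_gcd fun i _ => ?_
      rw [← Nat.mul_div_cancel' (diffGcd_dvd (hd := hd) (n := n) i)]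
      exact Nat.mul_dvd_mul_left _ (Nat.setGcd_dvd_of_mem (Set.mem_range_self i))
    exact Nat.dvd_one.1 (Nat.dvd_of_mul_dvd_mul_left (diffGcd_pos hn) h)
  obtain ⟨c, hc⟩ := Nat.exists_mem_closure_of_ge (Set.range fun i => diff hd n i / diffGcd hd n)
  exact Nat.sInf_mem (s := {c | ∀ x, c ≤ x → x ∈ diffSemigroup hd n})
    ⟨c, fun x hx => hc x hx (hg ▸ one_dvd x)⟩ x hx

/-- A multiple of `g` beyond `g c` is a combination of the `m_i` with few terms: not using
`m_d = 0`, each term contributes at least `m_{d-1}`. -/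
theorem exists_sum_mul_diff_eq (hn : StrictMono n) {x : ℕ} (hx : diffGcd hd n ∣ x)
    (hcx : diffGcd hd n * conductor (diffSemigroup hd n) ≤ x) :
    ∃ r : Fin d → ℕ, ∑ i, r i * diff hd n i = x ∧
      totalOrder r * diff hd n ⟨d - 2, by omega⟩ ≤ x := by
  obtain ⟨y, rfl⟩ := hx
  have hy := Nat.le_of_mul_le_mul_left hcx (diffGcd_pos hn)
  obtain ⟨r, hr⟩ := mem_semigroup_iff.1 (mem_diffSemigroup_of_conductor_le hn hy)
  have hsum : ∑ i, r i * diff hd n i = diffGcd hd n * y := by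
    rw [← show _ = y from hr, Finset.mul_sum]
    refine Finset.sum_congr rfl fun i _ => ?_
    rw [mul_left_comm, Nat.mul_div_cancel' (diffGcd_dvd i)]
  set r' : Fin d → ℕ := Function.update r ⟨d - 1, by omega⟩ 0
  have hsum' : ∑ i, r' i * diff hd n i = diffGcd hd n * y := by
    rw [← hsum]
    refine Finset.sum_congr rfl fun i _ => ?_
    by_cases hi : i = ⟨d - 1, by omega⟩
    · rw [hi, diff_last, mul_zero, mul_zero]
    · rw [show r' i = r i from Function.update_of_ne hi _ _]
  refine ⟨r', hsum', hsum' ▸ ?_⟩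
  rw [totalOrder, Finset.sum_mul]
  refine Finset.sum_le_sum fun i _ => ?_
  by_cases hi : i = ⟨d - 1, by omega⟩
  · simp [r', hi]
  · refine Nat.mul_le_mul_left _ (diff_le_diff hn (Fin.le_def.2 ?_))
    have : (i : ℕ) ≠ d - 1 := fun h => hi (Fin.ext h)
    simp only
    omega

/-- The bound on the shift cleared of denominators. -/
theorem shiftBound_lt_iff (hn : StrictMono n) {j : ℕ} :
    shiftBound hd n < j ↔
      diff hd n ⟨0, by omega⟩ * diff hd n ⟨1, by omega⟩ *
        (diffGcd hd n * conductor (diffSemigroup hd n) + d * diff hd n ⟨0, by omega⟩ +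
          d * diff hd n ⟨d - 2, by omega⟩) <
      (n ⟨d - 1, by omega⟩ + j) * diff hd n ⟨d - 2, by omega⟩ := by
  have hpos : 0 < diff hd n ⟨d - 2, by omega⟩ :=
    (Nat.zero_le _).trans_lt
      (diff_lt_diff (l := ⟨d - 1, by omega⟩) hn (by simp [Fin.lt_def]; omega))
  have hq : (0 : ℚ) < diff hd n ⟨d - 2, by omega⟩ := by exact_mod_cast hpos
  rw [shiftBound, sub_lt_iff_lt_add', div_add' _ _ _ hq.ne', ← mul_div_assoc, div_lt_iff₀ hq]
  exact_mod_cast Iff.rfl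

/-- A factorization that is longer than another one can be replaced by one of the same total order
that uses the least generator. Two different total orders force `M = ∑ a_i m_i` to be at least
`n_d + j`. If `a_1 = 0`, writing `M` with `m_1` in place of the smaller `m_2, …, m_{d-1}` saves more
terms than are needed for the remainder, and the saved terms are filled up with `m_d = 0`. -/
theorem exists_factorization_ne_zero (hpos : ∀ i, 0 < n i) (hn : StrictMono n) {j : ℕ}
    (hj : shiftBound hd n < j) {s : ℕ} {a a' : Fin d → ℕ}
    (ha : a ∈ factorizations (shift n j) s) (ha' : a' ∈ factorizations (shift n j) s)
    (hlt : totalOrder a' < totalOrder a) :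
    ∃ b ∈ factorizations (shift n j) s, totalOrder b = totalOrder a ∧ b ⟨0, by omega⟩ ≠ 0 := by
  by_cases ha0 : a ⟨0, by omega⟩ = 0
  swap
  · exact ⟨a, ha, rfl, ha0⟩
  have hsa := sum_mul_shift_add_sum_mul_diff (hd := hd) hn j a
  have hsa' := sum_mul_shift_add_sum_mul_diff (hd := hd) hn j a'
  rw [show _ = s from ha] at hsa
  rw [show _ = s from ha'] at hsa'
  set N := n ⟨d - 1, by omega⟩ + j
  have hN : 0 < N := Nat.add_pos_left (hpos _) j
  set M := ∑ i, a i * diff hd n i with hM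
  have hNM : N ≤ M := by
    have : (totalOrder a' + 1) * N ≤ totalOrder a * N := Nat.mul_le_mul_right _ hlt
    rw [add_mul, one_mul] at this
    omega
  have hMa : M ≤ totalOrder a * diff hd n ⟨1, by omega⟩ := by
    rw [hM, totalOrder, Finset.sum_mul]
    refine Finset.sum_le_sum fun i _ => ?_
    by_cases hi : i = ⟨0, by omega⟩
    · simp [hi, ha0]
    · refine Nat.mul_le_mul_left _ (diff_le_diff hn (Fin.le_def.2 ?_))
      have : (i : ℕ) ≠ 0 := fun h => hi (Fin.ext h)
      simp only
      omega
  -- For `d = 2` one has `m_2 = m_d = 0`, and a factorization with `a_1 = 0` is the shortest one.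
  have h3 : 3 ≤ d := by
    by_contra h
    obtain rfl : d = 2 := by omega
    rw [show diff hd n ⟨1, by omega⟩ = 0 from diff_last, mul_zero] at hMa
    omega
  rw [shiftBound_lt_iff hn] at hj
  have h10 : diff hd n ⟨1, by omega⟩ < diff hd n ⟨0, by omega⟩ :=
    diff_lt_diff hn (by simp [Fin.lt_def])
  have h21 : diff hd n ⟨d - 2, by omega⟩ ≤ diff hd n ⟨1, by omega⟩ :=
    diff_le_diff hn (Fin.le_def.2 (by simp only; omega))
  have h2 : 0 < diff hd n ⟨d - 2, by omega⟩ :=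
    (Nat.zero_le _).trans_lt
      (diff_lt_diff (l := ⟨d - 1, by omega⟩) hn (by simp [Fin.lt_def]; omega))
  set m₀ := diff hd n ⟨0, by omega⟩ with hm₀
  set m₁ := diff hd n ⟨1, by omega⟩
  set m₂ := diff hd n ⟨d - 2, by omega⟩
  set C := diffGcd hd n * conductor (diffSemigroup hd n) with hC
  have hbound : m₀ * m₁ * (C + m₀) ≤ M * m₂ := by
    have h1 : m₀ * m₁ * (C + m₀) ≤ m₀ * m₁ * (C + d * m₀ + d * m₂) := by
      refine Nat.mul_le_mul_left _ ?_
      nlinarith [Nat.mul_le_mul_right m₀ (show 1 ≤ d by omega)]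
    exact h1.trans (hj.le.trans (Nat.mul_le_mul_right _ hNM))
  have hCM : C + m₀ ≤ M := by
    have h1 : m₁ * (C + m₀) ≤ m₀ * m₁ * (C + m₀) :=
      Nat.mul_le_mul_right _ (Nat.le_mul_of_pos_left _ (by omega))
    have h4 : m₁ * (C + m₀) ≤ m₁ * M :=
      h1.trans (hbound.trans (by rw [mul_comm]; exact Nat.mul_le_mul_right _ h21))
    exact Nat.le_of_mul_le_mul_left h4 (by omega)
  -- `q` copies of `m_1` leave a remainder in `[g c, g c + m_1)`, just beyond the conductor.
  set q := (M - C) / m₀ with hq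
  have hdiv := Nat.div_add_mod (M - C) m₀
  have hmod := Nat.mod_lt (M - C) (show 0 < m₀ by omega)
  rw [← hq] at hdiv
  have hq1 : 1 ≤ q := (Nat.one_le_div_iff (by omega)).2 (by omega)
  have hgM : diffGcd hd n ∣ M :=
    Finset.dvd_sum fun i _ => Dvd.dvd.mul_left (diffGcd_dvd i) _
  obtain ⟨r, hr, hrl⟩ := exists_sum_mul_diff_eq (hd := hd) hn (x := M - m₀ * q)
    (Nat.dvd_sub hgM (Dvd.dvd.mul_right (diffGcd_dvd _) _)) (by rw [← hC]; omega)
  change totalOrder r * m₂ ≤ M - m₀ * q at hrl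
  have hlen : q + totalOrder r ≤ totalOrder a := by
    have hpos' : 0 < m₀ * m₁ * m₂ := by
      have : 0 < m₁ := by omega
      have : 0 < m₀ := by omega
      positivity
    refine Nat.le_of_mul_le_mul_left ?_ hpos'
    have e1 : m₁ * m₂ * (m₀ * q) ≤ m₁ * m₂ * M := Nat.mul_le_mul_left _ (by omega)
    have e2 : m₀ * m₁ * (totalOrder r * m₂) ≤ m₀ * m₁ * (C + m₀) :=
      Nat.mul_le_mul_left _ (by omega)
    have e3 : m₂ * M * (m₁ + 1) ≤ m₂ * M * m₀ := Nat.mul_le_mul_left _ h10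
    have e4 : m₂ * m₀ * M ≤ m₂ * m₀ * (totalOrder a * m₁) := Nat.mul_le_mul_left _ hMa
    linarith
  set b : Fin d → ℕ := r + Pi.single ⟨0, by omega⟩ q +
    Pi.single ⟨d - 1, by omega⟩ (totalOrder a - (q + totalOrder r)) with hb
  have hbl : totalOrder b = totalOrder a := by
    rw [hb, totalOrder_add, totalOrder_add, totalOrder_single, totalOrder_single]
    omega
  have hbM : ∑ i, b i * diff hd n i = M := by
    have f1 := add_mem_factorizations (add_mem_factorizations (n := diff hd n) hr
      (single_mem_factorizations ⟨0, by omega⟩ q))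
      (single_mem_factorizations ⟨d - 1, by omega⟩ (totalOrder a - (q + totalOrder r)))
    rw [diff_last, mul_zero, add_zero, ← hb, ← hm₀, mul_comm q] at f1
    exact f1.trans (by omega)
  refine ⟨b, ?_, hbl, ?_⟩
  · have hsb := sum_mul_shift_add_sum_mul_diff (hd := hd) hn j b
    rw [hbM, hbl] at hsb
    change _ = totalOrder a * N at hsb
    change ∑ i, _ = s
    omega
  · have : b ⟨0, by omega⟩ = r ⟨0, by omega⟩ + q +
        (Pi.single ⟨d - 1, by omega⟩ (totalOrder a - (q + totalOrder r)) : Fin d → ℕ)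
          ⟨0, by omega⟩ := by simp [hb]
    omega

/-- If an element of the Apéry set had two total orders, it would have a factorization using `n_1`. -/
theorem isHomogeneousSemigroup_of_exists_ne_zero
    (h : ∀ s, ∀ a ∈ factorizations n s, ∀ a' ∈ factorizations n s,
      totalOrder a' < totalOrder a →
        ∃ b ∈ factorizations n s, totalOrder b = totalOrder a ∧ b ⟨0, by omega⟩ ≠ 0) :
    IsHomogeneousSemigroup hd n := by
  rintro s ⟨hs, hap⟩ -
  have hle : ∀ a ∈ factorizations n s, ∀ a' ∈ factorizations n s,
      totalOrder a ≤ totalOrder a' := by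
    intro a ha a' ha'
    by_contra! hlt
    obtain ⟨b, hb, -, hb0⟩ := h s a ha a' ha' hlt
    have hns : n ⟨0, by omega⟩ ≤ s := by
      rw [← show _ = s from hb]
      exact (Nat.le_mul_of_pos_left _ (Nat.pos_of_ne_zero hb0)).trans
        (Finset.single_le_sum (f := fun i => b i * n i) (fun _ _ => Nat.zero_le _)
          (Finset.mem_univ _))
    rw [← Nat.sub_add_cancel hns] at hb
    obtain ⟨c, hc, -⟩ := sub_single_mem_factorizations hb hb0
    exact hap ⟨_, mem_semigroup_iff.2 ⟨c, hc⟩, (Nat.sub_add_cancel hns).symm⟩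
  obtain ⟨a, ha⟩ := mem_semigroup_iff.1 hs
  refine ⟨totalOrder a, Set.Subset.antisymm ?_ ?_⟩
  · rintro _ ⟨a', ha', rfl⟩
    exact le_antisymm (hle a' ha' a ha) (hle a ha a' ha')
  · rintro _ rfl
    exact ⟨a, ha, rfl⟩

/-- If `s + n i` had a factorization longer than those of `s` allow, it could be chosen to use `n i`,
and removing one copy gives a factorization of `s`. -/
theorem exists_factorization_totalOrder_le_add_one {i : Fin d}
    (h : ∀ s, ∀ a ∈ factorizations n s, ∀ a' ∈ factorizations n s,
      totalOrder a' < totalOrder a →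
        ∃ b ∈ factorizations n s, totalOrder b = totalOrder a ∧ b i ≠ 0) {s : ℕ}
    (hs : s ∈ semigroup n) {a : Fin d → ℕ} (ha : a ∈ factorizations n (s + n i)) :
    ∃ b ∈ factorizations n s, totalOrder a ≤ totalOrder b + 1 := by
  obtain ⟨c, hc⟩ := mem_semigroup_iff.1 hs
  by_cases hle : totalOrder a ≤ totalOrder c + 1
  · exact ⟨c, hc, hle⟩
  have hc' := add_mem_factorizations hc (single_mem_factorizations i 1)
  rw [one_mul] at hc'
  obtain ⟨b, hb, hba, hb0⟩ := h _ a ha _ hc' (by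
    rw [totalOrder_add, totalOrder_single]
    omega)
  obtain ⟨e, he, hbe⟩ := sub_single_mem_factorizations hb hb0
  exact ⟨e, he, (hba.symm.trans hbe).le⟩

end Shift

end ShiftedSemigroup

theorem mainTheorem4 (k : Type*) [Field k] (d : ℕ) (hd : 2 ≤ d) (n : Fin d → ℕ)
    (hpos : ∀ i, 0 < n i) (hn : StrictMono n)
    (j : ℕ) (hj : ShiftedSemigroup.shiftBound hd n < (j : ℚ)) :
    (∀ s ∈ ShiftedSemigroup.semigroup (ShiftedSemigroup.shift n j),
      ∀ a ∈ ShiftedSemigroup.factorizations (ShiftedSemigroup.shift n j) s,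
      ∀ a' ∈ ShiftedSemigroup.factorizations (ShiftedSemigroup.shift n j) s,
        ShiftedSemigroup.totalOrder a' < ShiftedSemigroup.totalOrder a →
        ∃ b ∈ ShiftedSemigroup.factorizations (ShiftedSemigroup.shift n j) s,
          ShiftedSemigroup.totalOrder b = ShiftedSemigroup.totalOrder a ∧
            b ⟨0, by omega⟩ ≠ 0) ∧
    ShiftedSemigroup.IsHomogeneousSemigroup hd (ShiftedSemigroup.shift n j) ∧
    ShiftedSemigroup.IsCohenMacaulayRing
      (ShiftedSemigroup.TangentCone k (ShiftedSemigroup.shift n j)) := by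
  have key := fun s a ha a' ha' hlt =>
    ShiftedSemigroup.exists_factorization_ne_zero (s := s) (a := a) (a' := a') hpos hn hj ha ha' hlt
  refine ⟨fun s _ => key s, ShiftedSemigroup.isHomogeneousSemigroup_of_exists_ne_zero key,
    ShiftedSemigroup.isCohenMacaulayRing_tangentCone ⟨0, by omega⟩ (fun i hi => ?_)
      fun s hs a ha => ShiftedSemigroup.exists_factorization_totalOrder_le_add_one key hs ha⟩
  have : n ⟨0, by omega⟩ < n i :=
    hn (Fin.lt_def.2 (Nat.pos_of_ne_zero fun h => hi (Fin.ext h)))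
  exact Nat.add_lt_add_right this j
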